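/- Let $H$ be an amenable, unimodular, locally compact (Hausdorff) group with Haar measure $dh$, where amenable means that there is a left invariant mean on the bounded continuous real functions on $H$. Let $c:H\times H\to\mathbb{T}$ be a continuous function with values of modulus one satisfying $c(h_1,h_2)\,c(h_1h_2,h_3)=c(h_1,h_2h_3)\,c(h_2,h_3)$ for all $h_1,h_2,h_3\in H$. Let $\pi$ be a projective unitary representation of $H$ on a complex Hilbert space $\mathcal{H}$ with multiplier $\overline{c}$, i.e. a family of unitary operators $\pi(h)$, $h\in H$, with $\pi(h_1h_2)=c(h_1,h_2)\,\pi(h_1)\pi(h_2)$. Let $L\subseteq\mathcal{H}$ be a linear subspace such that for all $\psi,\varphi\in L$ the function $$\langle\psi,\varphi\rangle_{C_c(H,c)}:\ h\mapsto(\pi(h)\varphi,\psi)$$ (the inner product being linear in the first entry) belongs to $C_c(H)$. Let $C_c(H,c)$ be the $*$-algebra $C_c(H)$ with the product and involution $$(f*_cg)(h)=\int_H f(hk^{-1})\,g(k)\,c(hk^{-1},k)\,dk,\qquad f^{*_c}(h)=\overline{c(1,1)\,c(h,h^{-1})\,f(h^{-1})},$$ and let the twisted group algebra $C^*(H,c)$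 be its enveloping $C^*$-algebra: the completion of $C_c(H,c)$ in the norm $\|f\|=\sup_\rho\|\rho(f)\|$, where $\rho$ runs over the $*$-representations of $C_c(H,c)$ by bounded operators on Hilbert spaces with $\|\rho(f)\|\le\int_H|f(h)|\,dh$ for all $f$. Then the rigging map $\langle\cdot,\cdot\rangle_{C_c(H,c)}$ is positive: for every $\psi\in L$, the (image of the) element $\langle\psi,\psi\rangle_{C_c(H,c)}$ is a positive element of the $C^*$-algebra $C^*(H,c)$. -/

import Mathlib

open MeasureTheory
open scoped ENNReal CompactlySupported BoundedContinuousFunction Pointwise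

/-- A topological group is amenable if there is a left invariant mean on its bounded continuous
real functions: a positive, normalized linear functional which is invariant under all left
translations `f ↦ f (g * ·)`. -/
def IsAmenableGroup (H : Type*) [Group H] [TopologicalSpace H] [ContinuousMul H] : Prop :=
  ∃ m : (H →ᵇ ℝ) →ₗ[ℝ] ℝ,
    (∀ f : H →ᵇ ℝ, (∀ x, 0 ≤ f x) → 0 ≤ m f) ∧
    m (BoundedContinuousFunction.const H 1) = 1 ∧
    ∀ (g : H) (f : H →ᵇ ℝ), m (f.compContinuous ⟨fun x => g * x, continuous_const_mul g⟩) = m f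

/-- A (continuous) multiplier on a topological group: a function of two variables with values
of modulus one, satisfying the cocycle identity. The normalization `c 1 1 = 1` is not
required. -/
structure GroupMultiplier (H : Type*) [Group H] [TopologicalSpace H] where
  /-- the underlying function -/
  toFun : H → H → Circle
  continuous_toFun : Continuous fun p : H × H => toFun p.1 p.2
  cocycle : ∀ h₁ h₂ h₃ : H,
    toFun h₁ h₂ * toFun (h₁ * h₂) h₃ = toFun h₁ (h₂ * h₃) * toFun h₂ h₃

namespace GroupMultiplier

variable {H : Type*} [Group H] [TopologicalSpace H]

instance : CoeFun (GroupMultiplier H) (fun _ => H → H → Circle) := ⟨toFun⟩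

theorem one_left (c : GroupMultiplier H) (x : H) : c 1 x = c 1 1 := by
  have h := c.cocycle 1 1 x
  simp only [one_mul] at h
  exact (mul_right_cancel h).symm

theorem one_right (c : GroupMultiplier H) (x : H) : c x 1 = c 1 1 := by
  have h := c.cocycle x 1 1
  simp only [mul_one] at h
  exact mul_left_cancel h

theorem inv_swap (c : GroupMultiplier H) (x : H) : c x⁻¹ x = c x x⁻¹ := by
  have h := c.cocycle x x⁻¹ x
  rw [mul_inv_cancel, inv_mul_cancel, c.one_left x, c.one_right x, mul_comm] at h
  exact (mul_left_cancel h).symm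

/-- The factor in the involution of the twisted group algebra. For a normalized multiplier
(`c 1 1 = 1`) it is the complex conjugate of `c h h⁻¹`. -/
noncomputable def starFactor (c : GroupMultiplier H) (h : H) : Circle := (c 1 1)⁻¹ * (c h h⁻¹)⁻¹

theorem starFactor_inv (c : GroupMultiplier H) (h : H) : c.starFactor h⁻¹ = c.starFactor h := by
  simp only [starFactor, inv_inv, c.inv_swap]

theorem starFactor_mul (c : GroupMultiplier H) (a b : H) :
    c.starFactor (a * b) * (c b⁻¹ a⁻¹)⁻¹ = c.starFactor a * c.starFactor b * c a b := by
  have h1 := c.cocycle a b (b⁻¹ * a⁻¹)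
  have h2 := c.cocycle b b⁻¹ a⁻¹
  rw [mul_inv_cancel, c.one_left] at h2
  rw [mul_inv_cancel_left] at h1
  have key : c a a⁻¹ * c b b⁻¹ * c 1 1 = c a b * c (a * b) (b⁻¹ * a⁻¹) * c b⁻¹ a⁻¹ := by
    rw [h1, mul_assoc, h2, mul_assoc]
  simp only [starFactor, mul_inv_rev]
  have e1 : (c 1 1)⁻¹ * (c (a * b) (b⁻¹ * a⁻¹))⁻¹ * (c b⁻¹ a⁻¹)⁻¹
      = (c 1 1)⁻¹ * (c a b * c (a * b) (b⁻¹ * a⁻¹) * c b⁻¹ a⁻¹)⁻¹ * c a b := by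
    simp only [mul_inv]
    rw [mul_assoc, mul_assoc (c 1 1)⁻¹]
    congr 1
    rw [mul_right_comm _ _ (c a b), mul_right_comm _ _ (c a b), inv_mul_cancel, one_mul]
  rw [e1, ← key]
  simp only [mul_inv]
  congr 1
  simp only [mul_comm, mul_left_comm, mul_assoc]

theorem continuous_comp (c : GroupMultiplier H) {X : Type*} [TopologicalSpace X] {u v : X → H}
    (hu : Continuous u) (hv : Continuous v) : Continuous fun x => (c (u x) (v x) : ℂ) :=
  continuous_subtype_val.comp (c.continuous_toFun.comp (hu.prodMk hv))

theorem continuous_starFactor [IsTopologicalGroup H] (c : GroupMultiplier H) :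
    Continuous fun h => (c.starFactor h : ℂ) := by
  refine continuous_subtype_val.comp (continuous_const.mul ?_)
  exact (c.continuous_toFun.comp (continuous_id.prodMk continuous_inv)).inv

end GroupMultiplier

noncomputable section

/-- The space `C_c(H)` of continuous compactly supported complex functions on `H`, as the
underlying vector space of the twisted convolution algebra `C_c(H, c)`, where `μ` is the
Haar measure used in the convolution. -/
def TwistedCc {H : Type*} [Group H] [TopologicalSpace H] [MeasurableSpace H]
    (_c : GroupMultiplier H) (_μ : Measure H) : Type _ := C_c(H, ℂ)

namespace TwistedCc

variable {H : Type*} [Group H] [TopologicalSpace H] [MeasurableSpace H]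
  {c : GroupMultiplier H} {μ : Measure H}

instance : AddCommGroup (TwistedCc c μ) := inferInstanceAs (AddCommGroup C_c(H, ℂ))

instance : Module ℂ (TwistedCc c μ) := inferInstanceAs (Module ℂ C_c(H, ℂ))

instance : FunLike (TwistedCc c μ) H ℂ := inferInstanceAs (FunLike C_c(H, ℂ) H ℂ)

/-- An element of `C_c(H, c)` from a continuous function of compact support. -/
def mk (f : H → ℂ) (hf : Continuous f) (hc : HasCompactSupport f) : TwistedCc c μ :=
  (⟨⟨f, hf⟩, hc⟩ : C_c(H, ℂ))

@[simp] theorem mk_apply (f : H → ℂ) (hf : Continuous f) (hc : HasCompactSupport f) (h : H) :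
    (mk f hf hc : TwistedCc c μ) h = f h := rfl

@[simp] theorem add_apply (f g : TwistedCc c μ) (h : H) : (f + g) h = f h + g h := rfl

@[simp] theorem zero_apply (h : H) : (0 : TwistedCc c μ) h = 0 := rfl

@[simp] theorem smul_apply (z : ℂ) (f : TwistedCc c μ) (h : H) : (z • f) h = z * f h := rfl

@[ext] theorem ext {f g : TwistedCc c μ} (hfg : ∀ h, f h = g h) : f = g := DFunLike.ext f g hfg

theorem continuous (f : TwistedCc c μ) : Continuous f :=
  (show C_c(H, ℂ) from f).toContinuousMap.continuous

theorem hasCompactSupport (f : TwistedCc c μ) : HasCompactSupport f :=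
  (show C_c(H, ℂ) from f).hasCompactSupport'

variable [IsTopologicalGroup H]

theorem continuous_integrand (f g : TwistedCc c μ) :
    Continuous fun p : H × H => f (p.1 * p.2⁻¹) * g p.2 * c (p.1 * p.2⁻¹) p.2 :=
  ((f.continuous.comp (by fun_prop)).mul (g.continuous.comp (by fun_prop))).mul
    (c.continuous_comp (by fun_prop) (by fun_prop))

theorem continuous_conv [BorelSpace H] [IsFiniteMeasureOnCompacts μ] (f g : TwistedCc c μ) :
    Continuous fun h : H => ∫ k, f (h * k⁻¹) * g k * c (h * k⁻¹) k ∂μ := by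
  rw [← continuousOn_univ]
  refine continuousOn_integral_of_compact_support (k := tsupport g) g.hasCompactSupport
    (f.continuous_integrand g).continuousOn ?_
  intro p x _ hx
  simp [image_eq_zero_of_notMem_tsupport hx]

theorem hasCompactSupport_conv (f g : TwistedCc c μ) [T2Space H] :
    HasCompactSupport fun h : H => ∫ k, f (h * k⁻¹) * g k * c (h * k⁻¹) k ∂μ := by
  refine HasCompactSupport.intro
    (f.hasCompactSupport.isCompact.mul g.hasCompactSupport.isCompact) fun h hh => ?_
  have : ∀ k, f (h * k⁻¹) * g k * c (h * k⁻¹) k = 0 := by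
    intro k
    by_cases h1 : h * k⁻¹ ∈ tsupport f
    · by_cases h2 : k ∈ tsupport g
      · exact absurd ⟨_, h1, _, h2, by simp⟩ hh
      · simp [image_eq_zero_of_notMem_tsupport h2]
    · simp [image_eq_zero_of_notMem_tsupport h1]
  simp [this]

theorem integrable_integrand [BorelSpace H] [IsFiniteMeasureOnCompacts μ] (f g : TwistedCc c μ)
    (h : H) : Integrable (fun k => f (h * k⁻¹) * g k * c (h * k⁻¹) k) μ := by
  refine Continuous.integrable_of_hasCompactSupport
    ((f.continuous_integrand g).comp (by fun_prop : Continuous fun k : H => (h, k))) ?_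
  exact (g.hasCompactSupport.mul_left).mul_right

variable [BorelSpace H] [T2Space H]

/-- The twisted convolution product
`(f *_c g)(h) = ∫ f(h k⁻¹) g(k) c(h k⁻¹, k) dk` on `C_c(H, c)`. -/
instance [IsFiniteMeasureOnCompacts μ] : Mul (TwistedCc c μ) where
  mul f g := mk (fun h => ∫ k, f (h * k⁻¹) * g k * c (h * k⁻¹) k ∂μ)
    (f.continuous_conv g) (f.hasCompactSupport_conv g)

theorem mul_apply [IsFiniteMeasureOnCompacts μ] (f g : TwistedCc c μ) (h : H) :
    (f * g) h = ∫ k, f (h * k⁻¹) * g k * c (h * k⁻¹) k ∂μ := rfl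

/-- The involution `f^*(h) = conj (c(1,1) c(h, h⁻¹) f(h⁻¹))` on `C_c(H, c)`. -/
instance : Star (TwistedCc c μ) where
  star f := mk (fun h => (c.starFactor h : ℂ) * (starRingEnd ℂ) (f h⁻¹))
    (c.continuous_starFactor.mul
      (Complex.continuous_conj.comp (f.continuous.comp continuous_inv)))
    (((f.hasCompactSupport.comp_homeomorph (Homeomorph.inv H)).comp_left
      (g := starRingEnd ℂ) (map_zero _)).mul_left)

theorem star_apply (f : TwistedCc c μ) (h : H) :
    (star f) h = (c.starFactor h : ℂ) * (starRingEnd ℂ) (f h⁻¹) := rfl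

protected theorem mul_assoc [IsFiniteMeasureOnCompacts μ] [μ.IsMulRightInvariant]
    (f g e : TwistedCc c μ) : f * g * e = f * (g * e) := by
  ext h
  simp only [mul_apply]
  have h1 : ∀ k, (∫ l, f (h * k⁻¹ * l⁻¹) * g l * c (h * k⁻¹ * l⁻¹) l ∂μ) * e k * c (h * k⁻¹) k
      = ∫ m, f (h * m⁻¹) * (g (m * k⁻¹) * e k * c (m * k⁻¹) k) * c (h * m⁻¹) m ∂μ := by
    intro k
    rw [← integral_mul_right_eq_self _ k⁻¹, mul_assoc, ← integral_mul_const]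
    refine integral_congr_ae (Filter.Eventually.of_forall fun m => ?_)
    have hc := c.cocycle (h * m⁻¹) (m * k⁻¹) k
    have e1 : h * m⁻¹ * (m * k⁻¹) = h * k⁻¹ := by group
    have e2 : h * k⁻¹ * (m * k⁻¹)⁻¹ = h * m⁻¹ := by group
    rw [e1, inv_mul_cancel_right] at hc
    have hc' := congrArg (fun z : Circle => (z : ℂ)) hc
    simp only [Circle.coe_mul] at hc'
    simp only [e2]
    linear_combination (f (h * m⁻¹) * g (m * k⁻¹) * e k) * hc'
  have h2 : ∀ m, f (h * m⁻¹) * (∫ k, g (m * k⁻¹) * e k * c (m * k⁻¹) k ∂μ) * c (h * m⁻¹) m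
      = ∫ k, f (h * m⁻¹) * (g (m * k⁻¹) * e k * c (m * k⁻¹) k) * c (h * m⁻¹) m ∂μ := by
    intro m
    rw [integral_mul_const, integral_const_mul]
  simp only [h1, h2]
  refine integral_integral_swap_of_hasCompactSupport
    (f := fun k m => f (h * m⁻¹) * (g (m * k⁻¹) * e k * c (m * k⁻¹) k) * c (h * m⁻¹) m) ?_ ?_
  · refine ((f.continuous.comp (by fun_prop)).mul
      (((g.continuous.comp (by fun_prop)).mul (e.continuous.comp (by fun_prop))).mul
        (c.continuous_comp (by fun_prop) (by fun_prop)))).mul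
      (c.continuous_comp (by fun_prop) (by fun_prop))
  · refine HasCompactSupport.intro (K := tsupport e ×ˢ (tsupport g * tsupport e))
      (e.hasCompactSupport.isCompact.prod
        (g.hasCompactSupport.isCompact.mul e.hasCompactSupport.isCompact)) ?_
    rintro ⟨k, m⟩ hkm
    simp only [Function.uncurry_apply_pair]
    by_cases hk : k ∈ tsupport e
    · by_cases hm : m * k⁻¹ ∈ tsupport g
      · exact absurd ⟨hk, _, hm, _, hk, by simp⟩ hkm
      · simp [image_eq_zero_of_notMem_tsupport hm]
    · simp [image_eq_zero_of_notMem_tsupport hk]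

protected theorem star_mul' [IsFiniteMeasureOnCompacts μ] [μ.IsMulRightInvariant]
    (f g : TwistedCc c μ) : star (f * g) = star g * star f := by
  ext h
  rw [star_apply, mul_apply, mul_apply, ← integral_conj, ← integral_const_mul,
    ← integral_mul_right_eq_self _ h⁻¹]
  refine integral_congr_ae (Filter.Eventually.of_forall fun k => ?_)
  have e1 : h⁻¹ * (k * h⁻¹)⁻¹ = k⁻¹ := by group
  have e2 : (h * k⁻¹)⁻¹ = k * h⁻¹ := by group
  have hc := c.starFactor_mul (h * k⁻¹) k
  rw [inv_mul_cancel_right, e2] at hc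
  have hc' := congrArg (fun z : Circle => (z : ℂ)) hc
  simp only [Circle.coe_mul, Circle.coe_inv_eq_conj] at hc'
  simp only [e1, e2, star_apply, map_mul]
  linear_combination ((starRingEnd ℂ) (f k⁻¹) * (starRingEnd ℂ) (g (k * h⁻¹))) * hc'

/-- `C_c(H, c)` is an associative algebra under twisted convolution. -/
instance [IsFiniteMeasureOnCompacts μ] [μ.IsMulRightInvariant] :
    NonUnitalRing (TwistedCc c μ) where
  left_distrib f g e := by
    ext h
    simp only [mul_apply, add_apply]
    rw [← integral_add (f.integrable_integrand g h) (f.integrable_integrand e h)]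
    congr 1 with k
    ring
  right_distrib f g e := by
    ext h
    simp only [mul_apply, add_apply]
    rw [← integral_add (f.integrable_integrand e h) (g.integrable_integrand e h)]
    congr 1 with k
    ring
  zero_mul f := by ext h; simp [mul_apply]
  mul_zero f := by ext h; simp [mul_apply]
  mul_assoc := TwistedCc.mul_assoc

/-- `C_c(H, c)` is a `*`-algebra. -/
instance [IsFiniteMeasureOnCompacts μ] [μ.IsMulRightInvariant] : StarRing (TwistedCc c μ) where
  star_involutive f := by
    ext h
    simp only [star_apply, map_mul, inv_inv, Complex.conj_conj, c.starFactor_inv]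
    rw [← mul_assoc, Complex.mul_conj, Circle.normSq_coe]
    simp
  star_mul := TwistedCc.star_mul'
  star_add f g := by
    ext h
    simp only [star_apply, add_apply, map_add, mul_add]

instance [IsFiniteMeasureOnCompacts μ] : IsScalarTower ℂ (TwistedCc c μ) (TwistedCc c μ) where
  smul_assoc z f g := by
    ext h
    simp only [smul_eq_mul, mul_apply, smul_apply, ← integral_const_mul]
    congr 1 with k
    ring

instance [IsFiniteMeasureOnCompacts μ] : SMulCommClass ℂ (TwistedCc c μ) (TwistedCc c μ) where
  smul_comm z f g := by
    ext h
    simp only [smul_eq_mul, mul_apply, smul_apply, ← integral_const_mul]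
    congr 1 with k
    ring

instance : StarModule ℂ (TwistedCc c μ) where
  star_smul z f := by
    ext h
    simp only [star_apply, smul_apply, map_mul, ← starRingEnd_apply]
    ring

end TwistedCc

universe u

section CStar

variable {H : Type u} [Group H] [TopologicalSpace H] [IsTopologicalGroup H] [T2Space H]
  [MeasurableSpace H] [BorelSpace H]
  (c : GroupMultiplier H) (μ : Measure H) [IsFiniteMeasureOnCompacts μ] [μ.IsMulRightInvariant]

/-- A `*`-representation of `C_c(H, c)` by bounded operators on a Hilbert space, contractive for
the `L¹`-norm; that is, the restriction to `C_c(H, c)` of a `*`-representation of the Banach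
`*`-algebra `L¹(H, c)`. -/
structure TwistedRep where
  /-- the Hilbert space of the representation -/
  space : Type u
  [normedAddCommGroup : NormedAddCommGroup space]
  [innerProductSpace : InnerProductSpace ℂ space]
  [completeSpace : CompleteSpace space]
  /-- the representation -/
  rep : TwistedCc c μ →⋆ₙₐ[ℂ] (space →L[ℂ] space)
  norm_rep_le : ∀ f : TwistedCc c μ, ‖rep f‖ ≤ ∫ h, ‖f h‖ ∂μ

attribute [instance] TwistedRep.normedAddCommGroup TwistedRep.innerProductSpace
  TwistedRep.completeSpace

/-- The bounded operators on the space of a representation. -/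
abbrev TwistedRep.Op (ρ : TwistedRep c μ) : Type u := ρ.space →L[ℂ] ρ.space

instance : Module ℂ (lp (fun ρ : TwistedRep c μ => TwistedRep.Op c μ ρ) ∞) :=
  NormedSpace.toModule

instance : SMul ℂ (lp (fun ρ : TwistedRep c μ => TwistedRep.Op c μ ρ) ∞) :=
  Module.toDistribMulAction.toSMul

/-- The universal representation of `C_c(H, c)`: the family of all its representations, as a
`*`-homomorphism to the `C^*`-algebra of bounded families of operators, with the supremum
norm. -/
def universalTwistedRep :
    TwistedCc c μ →⋆ₙₐ[ℂ] lp (fun ρ : TwistedRep c μ => TwistedRep.Op c μ ρ) ∞ where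
  toFun f := ⟨fun ρ => ρ.rep f, memℓp_infty
    ⟨∫ h, ‖f h‖ ∂μ, by rintro _ ⟨ρ, rfl⟩; exact ρ.norm_rep_le f⟩⟩
  map_smul' z f := by ext ρ : 2; exact map_smul ρ.rep z f
  map_zero' := by ext ρ : 2; exact map_zero ρ.rep
  map_add' f g := by ext ρ : 2; exact map_add ρ.rep f g
  map_mul' f g := by ext ρ : 2; exact map_mul ρ.rep f g
  map_star' f := by ext ρ : 2; exact map_star ρ.rep f

/-- The (full) twisted group `C^*`-algebra `C^*(H, c)`: the enveloping `C^*`-algebra of the twisted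
convolution algebra, i.e. its completion in the norm `‖f‖ = sup_ρ ‖ρ(f)‖` over all
`*`-representations `ρ`, realized as the norm closure of the image of the universal
representation. (Every cyclic representation is unitarily equivalent to one on a space in the
universe of `H`.) -/
def TwistedGroupCStarAlgebra : Type (u + 1) :=
  (NonUnitalStarAlgHom.range (universalTwistedRep c μ)).topologicalClosure

instance : NonUnitalCStarAlgebra (TwistedGroupCStarAlgebra c μ) :=
  NonUnitalStarSubalgebra.nonUnitalCStarAlgebra
    (NonUnitalStarAlgHom.range (universalTwistedRep c μ)).topologicalClosure
    (h_closed := NonUnitalStarSubalgebra.isClosed_topologicalClosure _)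

/-- The order of the `C^*`-algebra `C^*(H, c)`: `a ≤ b` if `b - a` is self-adjoint with
nonnegative spectrum. -/
instance : PartialOrder (TwistedGroupCStarAlgebra c μ) := CStarAlgebra.spectralOrder _

instance : StarOrderedRing (TwistedGroupCStarAlgebra c μ) := CStarAlgebra.spectralOrderedRing _

/-- The canonical `*`-homomorphism of `C_c(H, c)` into its enveloping `C^*`-algebra
`C^*(H, c)`. -/
def TwistedCc.toCStar : TwistedCc c μ →⋆ₙₐ[ℂ] TwistedGroupCStarAlgebra c μ where
  toFun f := ⟨universalTwistedRep c μ f,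
    NonUnitalStarSubalgebra.le_topologicalClosure _ ⟨f, rfl⟩⟩
  map_smul' z f := Subtype.ext (map_smul (universalTwistedRep c μ) z f)
  map_zero' := Subtype.ext (map_zero (universalTwistedRep c μ))
  map_add' f g := Subtype.ext (map_add (universalTwistedRep c μ) f g)
  map_mul' f g := Subtype.ext (map_mul (universalTwistedRep c μ) f g)
  map_star' f := Subtype.ext (map_star (universalTwistedRep c μ) f)

end CStar

/-- A projective unitary representation with multiplier `conj c`: unitary operators `π h` with
`π (h₁ h₂) = c (h₁, h₂) π h₁ π h₂`, that is `π h₁ π h₂ = conj (c (h₁, h₂)) π (h₁ h₂)`.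
No continuity is imposed here. -/
structure ProjectiveUnitaryRep {H : Type*} [Group H] [TopologicalSpace H] (c : GroupMultiplier H)
    (E : Type*) [NormedAddCommGroup E] [InnerProductSpace ℂ E] [CompleteSpace E] where
  /-- the underlying family of unitary operators -/
  toFun : H → unitary (E →L[ℂ] E)
  map_mul : ∀ h₁ h₂ : H, (toFun (h₁ * h₂) : E →L[ℂ] E)
    = (c h₁ h₂ : ℂ) • ((toFun h₁ : E →L[ℂ] E) * (toFun h₂ : E →L[ℂ] E))

namespace ProjectiveUnitaryRep

variable {H : Type*} [Group H] [TopologicalSpace H] {c : GroupMultiplier H}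
  {E : Type*} [NormedAddCommGroup E] [InnerProductSpace ℂ E] [CompleteSpace E]

/-- The function `h ↦ (π(h)φ, ψ)`, the inner product `( , )` being linear in the first entry.
(Mathlib's `inner ℂ` is linear in the second entry.) -/
def coefficient (π : ProjectiveUnitaryRep c E) (ψ φ : E) (h : H) : ℂ :=
  inner ℂ ψ ((π.toFun h : E →L[ℂ] E) φ)

/-- A subspace `L` is admissible if `h ↦ (π(h)φ, ψ)` is in `C_c(H)` for all `ψ, φ ∈ L`. -/
def IsAdmissible (π : ProjectiveUnitaryRep c E) (L : Submodule ℂ E) : Prop :=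
  ∀ ψ ∈ L, ∀ φ ∈ L, Continuous (π.coefficient ψ φ) ∧ HasCompactSupport (π.coefficient ψ φ)

/-- The rigging map `⟨ψ, φ⟩ : h ↦ (π(h)φ, ψ)` on an admissible subspace `L`, with values in
`C_c(H, c)`. -/
def riggingMap (π : ProjectiveUnitaryRep c E) {L : Submodule ℂ E} (hL : π.IsAdmissible L)
    [MeasurableSpace H] (μ : Measure H) (ψ φ : L) : TwistedCc c μ :=
  TwistedCc.mk (π.coefficient ψ φ) (hL ψ ψ.2 φ φ.2).1 (hL ψ ψ.2 φ φ.2).2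

end ProjectiveUnitaryRep

end

/-! Write `F` for the diagonal coefficient of `ψ` and `U_k` for the twisted left translation on
`C_c(H, c)`. Fix a representation `ρ`, put `T = ρ(F)`, and take a vector `ζ`. Both `k ↦ π(k)ψ` and
`k ↦ ρ(U_k F)ζ` satisfy only projective covariance relations, but with opposite phases, so these
cancel in `W(k) = π(k)ψ ⊗ ρ(U_k F)ζ`. Thus `⟨W(k), W(l)⟩` depends only on `k⁻¹l`, which makes `Φ(h)
= F(h)⟨Tζ, ρ(U_h F)ζ⟩` an ordinary function of positive type, compactly supported because `F` is.

On an amenable unimodular group such a function has integral with nonnegative real part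
(`IsAmenableGroup.re_integral_nonneg`). Reiter's condition, extracted from the invariant mean by
Hahn–Banach, gives `ξ ∈ C_c(H)` whose correlation `∫ ξ(k)ξ(kh) dk` is nearly 1 on the support of
`Φ`; the integral of `Φ` against this correlation is a squared norm up to conjugation.

Since `F * F = ∫ F(k) U_k F dk`, the integral of `Φ` is `⟨Tζ, T(Tζ)⟩`, so the self-adjoint operator
`T` has a positive cube and is itself positive. Positivity in all representations then passes to
`C^*(H, c)`, where it forces the negative part to vanish. -/

open Filter Topology

/-! ### `L¹`-bounded functionals on `C_c(X)`, and interchange with integrals. -/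

section LOneBounded

variable {X : Type*} [TopologicalSpace X] [T2Space X] [LocallyCompactSpace X] [MeasurableSpace X]
  [BorelSpace X]

/-- A real functional on `C_c(X)` which is bounded for the `L¹`-norm of `μ` becomes integration
against a measure after adding a multiple of `μ`. -/
theorem exists_regular_integral_eq_add (μ : Measure X) [IsFiniteMeasureOnCompacts μ]
    (Λ : C_c(X, ℝ) →ₗ[ℝ] ℝ) (C : ℝ) (hΛ : ∀ f, |Λ f| ≤ C * ∫ x, |f x| ∂μ) :
    ∃ ν : Measure X, ν.Regular ∧ ∀ f : C_c(X, ℝ), ∫ x, f x ∂ν = Λ f + C * ∫ x, f x ∂μ := by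
  let Λ₀ : C_c(X, ℝ) →ₗ[ℝ] ℝ :=
    { toFun := fun f => Λ f + C * ∫ x, f x ∂μ
      map_add' := fun f g => by
        simp only [map_add, CompactlySupportedContinuousMap.coe_add, Pi.add_apply]
        rw [integral_add f.integrable g.integrable]; ring
      map_smul' := fun r f => by
        simp only [map_smul, CompactlySupportedContinuousMap.coe_smul, Pi.smul_apply, smul_eq_mul,
          RingHom.id_apply]
        rw [integral_const_mul]; ring }
  -- For `f ≥ 0` the bound says `Λ f ≥ -C ∫ f`, so the shifted functional is positive and
  -- Riesz–Markov–Kakutani applies.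
  have hpos : ∀ f : C_c(X, ℝ), 0 ≤ f → 0 ≤ Λ₀ f := by
    intro f hf
    have h1 := neg_le_of_abs_le (hΛ f)
    have h2 : ∀ x, |f x| = f x := fun x => abs_of_nonneg (hf x)
    simp only [h2] at h1
    change 0 ≤ Λ f + C * ∫ x, f x ∂μ
    linarith
  exact ⟨RealRMK.rieszMeasure (PositiveLinearMap.mk₀ Λ₀ hpos), inferInstance,
    fun f => RealRMK.integral_rieszMeasure _ f⟩

/-- The complex-valued function attached to a real-valued one. -/
noncomputable def CompactlySupportedContinuousMap.ofRealLM : C_c(X, ℝ) →ₗ[ℝ] C_c(X, ℂ) where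
  toFun f := ⟨⟨fun x => (f x : ℂ), Complex.continuous_ofReal.comp f.continuous⟩,
    f.hasCompactSupport'.comp_left (g := ((↑) : ℝ → ℂ)) Complex.ofReal_zero⟩
  map_add' f g := by ext x; exact Complex.ofReal_add _ _
  map_smul' r f := by ext x; exact (Complex.ofReal_mul _ _).trans (Complex.real_smul).symm

open CompactlySupportedContinuousMap in
/-- A complex functional on `C_c(X)` which is bounded for the `L¹`-norm of `μ` is a linear
combination of integrals. -/
theorem exists_regular_integral_eq_complex (μ : Measure X) [IsFiniteMeasureOnCompacts μ]
    (Λ : C_c(X, ℂ) →ₗ[ℂ] ℂ) (C : ℝ) (hΛ : ∀ f, ‖Λ f‖ ≤ C * ∫ x, ‖f x‖ ∂μ) :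
    ∃ ν₁ ν₂ : Measure X, ν₁.Regular ∧ ν₂.Regular ∧ ∀ f : C_c(X, ℂ),
      Λ f = (∫ x, f x ∂ν₁ - C * ∫ x, f x ∂μ) + Complex.I * (∫ x, f x ∂ν₂ - C * ∫ x, f x ∂μ) := by
  let Λr : C_c(X, ℝ) →ₗ[ℝ] ℂ := Λ.restrictScalars ℝ ∘ₗ ofRealLM
  have hb : ∀ f, ‖Λr f‖ ≤ C * ∫ x, |f x| ∂μ := by
    intro f
    refine (hΛ _).trans_eq ?_
    congr 1
    exact integral_congr_ae (Eventually.of_forall fun x => Complex.norm_real _)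
  obtain ⟨ν₁, h₁, e₁⟩ := exists_regular_integral_eq_add μ (Complex.reLm ∘ₗ Λr) C
    fun f => (Complex.abs_re_le_norm _).trans (hb f)
  obtain ⟨ν₂, h₂, e₂⟩ := exists_regular_integral_eq_add μ (Complex.imLm ∘ₗ Λr) C
    fun f => (Complex.abs_im_le_norm _).trans (hb f)
  refine ⟨ν₁, ν₂, h₁, h₂, fun f => ?_⟩
  let fr : C_c(X, ℝ) := ⟨⟨fun x => (f x).re, Complex.continuous_re.comp f.continuous⟩,
    f.hasCompactSupport'.comp_left (g := Complex.re) rfl⟩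
  let fi : C_c(X, ℝ) := ⟨⟨fun x => (f x).im, Complex.continuous_im.comp f.continuous⟩,
    f.hasCompactSupport'.comp_left (g := Complex.im) rfl⟩
  have hf : f = ofRealLM fr + Complex.I • ofRealLM fi := by
    ext x
    change f x = ((f x).re : ℂ) + Complex.I * ((f x).im : ℂ)
    rw [mul_comm, Complex.re_add_im]
  have hint : ∀ (ν : Measure X) [IsFiniteMeasureOnCompacts ν],
      ∫ x, f x ∂ν = ((∫ x, fr x ∂ν : ℝ) : ℂ) + Complex.I * ((∫ x, fi x ∂ν : ℝ) : ℂ) := by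
    intro ν _
    rw [mul_comm]
    exact (integral_re_add_im f.integrable).symm
  have hΛr : ∀ g : C_c(X, ℝ), Λ (ofRealLM g)
      = ((∫ x, g x ∂ν₁ - C * ∫ x, g x ∂μ : ℝ) : ℂ)
        + Complex.I * ((∫ x, g x ∂ν₂ - C * ∫ x, g x ∂μ : ℝ) : ℂ) := by
    intro g
    rw [e₁, e₂, add_sub_cancel_right, add_sub_cancel_right, mul_comm]
    exact (Complex.re_add_im _).symm
  rw [hint ν₁, hint ν₂, hint μ]
  conv_lhs => rw [hf, map_add, map_smul, hΛr, hΛr]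
  push_cast
  rw [smul_eq_mul]
  linear_combination (0 : ℂ) * Complex.I_sq

omit [T2Space X] [LocallyCompactSpace X] in
theorem continuous_integral_of_hasCompactSupport_uncurry {Y E : Type*} [TopologicalSpace Y]
    [NormedAddCommGroup E] [NormedSpace ℝ E] (ν : Measure X) [IsFiniteMeasureOnCompacts ν]
    {G : Y → X → E} (hG : Continuous G.uncurry) (hc : HasCompactSupport G.uncurry) :
    Continuous fun y => ∫ x, G y x ∂ν := by
  rw [← continuousOn_univ]
  refine continuousOn_integral_of_compact_support (k := Prod.snd '' tsupport G.uncurry)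
    (hc.isCompact.image continuous_snd) hG.continuousOn fun p x _ hx => ?_
  by_contra h
  exact hx ⟨(p, x), subset_tsupport _ h, rfl⟩

omit [T2Space X] [LocallyCompactSpace X] in
theorem integrable_integral_of_hasCompactSupport_uncurry {Y E : Type*} [TopologicalSpace Y]
    [T2Space Y]
    [MeasurableSpace Y] [BorelSpace Y] (m : Measure Y) [IsFiniteMeasureOnCompacts m]
    [NormedAddCommGroup E] [NormedSpace ℝ E] (ν : Measure X) [IsFiniteMeasureOnCompacts ν]
    {G : Y → X → E} (hG : Continuous G.uncurry) (hc : HasCompactSupport G.uncurry) :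
    Integrable (fun y => ∫ x, G y x ∂ν) m := by
  refine (continuous_integral_of_hasCompactSupport_uncurry ν hG hc).integrable_of_hasCompactSupport
    (HasCompactSupport.intro (hc.isCompact.image continuous_fst) fun y hy => ?_)
  have : ∀ x, G y x = 0 := fun x => by
    by_contra h
    exact hy ⟨(y, x), subset_tsupport _ h, rfl⟩
  simp [this]

/-- An `L¹`-bounded functional on `C_c(X)` commutes with integrals of continuous compactly
supported families. -/
theorem map_integral_of_norm_le_integral {Y : Type*} [TopologicalSpace Y] [T2Space Y]
    [MeasurableSpace Y] [BorelSpace Y] (m : Measure Y) [IsFiniteMeasureOnCompacts m]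
    (μ : Measure X) [IsFiniteMeasureOnCompacts μ]
    (Λ : C_c(X, ℂ) →ₗ[ℂ] ℂ) (C : ℝ) (hΛ : ∀ f, ‖Λ f‖ ≤ C * ∫ x, ‖f x‖ ∂μ)
    (G : Y → C_c(X, ℂ)) (hG : Continuous fun p : Y × X => G p.1 p.2)
    (hc : HasCompactSupport fun p : Y × X => G p.1 p.2) (g : C_c(X, ℂ))
    (hg : ∀ x, g x = ∫ y, G y x ∂m) :
    Λ g = ∫ y, Λ (G y) ∂m := by
  -- With `Λ` a combination of integrals, the claim is Fubini for each measure; compact support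
  -- makes σ-finiteness unnecessary.
  obtain ⟨ν₁, ν₂, h₁, h₂, e⟩ := exists_regular_integral_eq_complex μ Λ C hΛ
  have hs : ∀ (ν : Measure X) [IsFiniteMeasureOnCompacts ν],
      ∫ x, g x ∂ν = ∫ y, ∫ x, G y x ∂ν ∂m := by
    intro ν _
    simp only [hg]
    exact (integral_integral_swap_of_hasCompactSupport (f := fun y x => G y x) hG hc).symm
  have hi : ∀ (ν : Measure X) [IsFiniteMeasureOnCompacts ν],
      Integrable (fun y => ∫ x, G y x ∂ν) m := fun ν _ =>
    integrable_integral_of_hasCompactSupport_uncurry m ν (G := fun y x => G y x) hG hc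
  have hd : ∀ (ν : Measure X) [IsFiniteMeasureOnCompacts ν],
      Integrable (fun y => ∫ x, G y x ∂ν - C * ∫ x, G y x ∂μ) m := fun ν _ =>
    (hi ν).sub ((hi μ).const_mul _)
  simp only [e]
  rw [integral_add (hd ν₁) ((hd ν₂).const_mul _), integral_const_mul,
    integral_sub (hi ν₁) ((hi μ).const_mul _), integral_sub (hi ν₂) ((hi μ).const_mul _),
    integral_const_mul, hs ν₁, hs ν₂, hs μ]

omit [T2Space X] [LocallyCompactSpace X] in
/-- A jointly continuous family with locally uniform compact supports is continuous in `L¹`. -/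
theorem tendsto_integral_norm_sub {Y E : Type*} [TopologicalSpace Y] [NormedAddCommGroup E]
    (μ : Measure X) [IsFiniteMeasureOnCompacts μ] {G : Y → X → E} (hG : Continuous G.uncurry)
    {y₀ : Y} {s : Set Y} (hs : s ∈ 𝓝 y₀) {K : Set X} (hK : IsCompact K)
    (hGK : ∀ y ∈ s, ∀ x ∉ K, G y x = 0) :
    Tendsto (fun y => ∫ x, ‖G y x - G y₀ x‖ ∂μ) (𝓝 y₀) (𝓝 0) := by
  have h := continuousOn_integral_of_compact_support (μ := μ)
    (f := fun y x => ‖G y x - G y₀ x‖) (s := s) hK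
    (by
      have : Continuous fun p : Y × X => G.uncurry (y₀, p.2) := hG.comp (by fun_prop)
      exact (hG.sub this).norm.continuousOn)
    (fun y x hy hx => by simp [hGK y hy x hx, hGK y₀ (mem_of_mem_nhds hs) x hx])
  simpa [ContinuousAt] using h.continuousAt hs

end LOneBounded

/-! ### Inversion invariance and uniqueness of Haar measure. -/

section Haar

variable {H : Type*} [Group H] [TopologicalSpace H] [IsTopologicalGroup H] [MeasurableSpace H]
  [BorelSpace H] [LocallyCompactSpace H]

open Measure in
/-- A regular Haar measure of a unimodular group is invariant under inversion. -/
theorem isInvInvariant_of_isMulRightInvariant (μ : Measure H) [μ.IsHaarMeasure] [μ.Regular]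
    [μ.IsMulRightInvariant] : μ.IsInvInvariant := by
  constructor
  let c : ℝ≥0∞ := haarScalarFactor μ.inv μ
  have hc : μ.inv = c • μ := isMulLeftInvariant_eq_smul_of_regular μ.inv μ
  -- Inverting twice restores `μ`, so `c² μ = μ`; a compact set of positive finite measure then
  -- forces `c = 1`.
  have h2 : Measure.map Inv.inv (Measure.map Inv.inv μ) = c ^ 2 • μ := by
    rw [← inv_def μ, hc, Measure.map_smul, ← inv_def μ, hc, smul_smul, pow_two]
  have μeq : μ = c ^ 2 • μ := by
    rwa [Measure.map_map continuous_inv.measurable continuous_inv.measurable,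
      (inv_involutive (G := H)).comp_self, Measure.map_id] at h2
  have K : TopologicalSpace.PositiveCompacts H := Classical.arbitrary _
  have h3 : c ^ 2 * μ K = 1 ^ 2 * μ K := by
    conv_rhs => rw [μeq]
    simp
  have h4 : c ^ 2 = 1 ^ 2 :=
    (ENNReal.mul_left_inj (measure_pos_of_nonempty_interior _ K.interior_nonempty).ne'
      K.isCompact.measure_lt_top.ne).1 h3
  rw [hc, (ENNReal.pow_right_strictMono two_ne_zero).injective h4, one_smul]

variable [T2Space H]

/-- The left translate `y ↦ f (x * y)` of a compactly supported function. -/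
def CompactlySupportedContinuousMap.mulLeft (x : H) (f : C_c(H, ℝ)) : C_c(H, ℝ) :=
  ⟨⟨fun y => f (x * y), f.continuous.comp (continuous_const_mul x)⟩,
    f.hasCompactSupport'.comp_homeomorph (Homeomorph.mulLeft x)⟩

/-- A left invariant `L¹`-bounded functional on `C_c(H)` is a multiple of the Haar integral. -/
theorem exists_eq_mul_integral_of_mulLeft (μ : Measure H) [μ.IsHaarMeasure]
    (Λ : C_c(H, ℝ) →ₗ[ℝ] ℝ) (C : ℝ) (hΛ : ∀ f, |Λ f| ≤ C * ∫ x, |f x| ∂μ)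
    (hinv : ∀ x f, Λ (f.mulLeft x) = Λ f) :
    ∃ d : ℝ, ∀ f : C_c(H, ℝ), Λ f = d * ∫ x, f x ∂μ := by
  obtain ⟨ν, hν, e⟩ := exists_regular_integral_eq_add μ Λ C hΛ
  -- `ν` represents `Λ + C ∫ · dμ`, a sum of left invariant functionals; regularity allows testing
  -- on `C_c(H)`.
  have : ν.IsMulLeftInvariant := by
    constructor
    intro g
    have : (Measure.map (fun x => g * x) ν).Regular :=
      Measure.Regular.map (Homeomorph.mulLeft g)
    refine Measure.ext_of_integral_eq_on_compactlySupported fun f => ?_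
    have h1 : ∫ x, f x ∂(Measure.map (fun x => g * x) ν) = ∫ x, f (g * x) ∂ν :=
      (Homeomorph.mulLeft g).measurableEmbedding.integral_map _
    have h2 := e (f.mulLeft g)
    have h3 : ∫ x, f.mulLeft g x ∂μ = ∫ x, f x ∂μ := integral_mul_left_eq_self f g
    rw [hinv, h3, ← e f] at h2
    exact h1.trans h2
  refine ⟨Measure.haarScalarFactor ν μ - C, fun f => ?_⟩
  have h := Measure.integral_isMulLeftInvariant_eq_smul_of_hasCompactSupport ν μ f.continuous
    f.hasCompactSupport'
  rw [integral_smul_nnreal_measure] at h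
  change ∫ x, f x ∂ν = _ • ∫ x, f x ∂μ at h
  rw [e f, NNReal.smul_def, smul_eq_mul] at h
  linarith

end Haar

/-! ### Reiter's condition from an invariant mean. -/

section Reiter

variable {H : Type*} [Group H] [TopologicalSpace H] [IsTopologicalGroup H] [T2Space H]
  [LocallyCompactSpace H] [MeasurableSpace H] [BorelSpace H]

namespace CompactlySupportedContinuousMap

/-- The right translate `y ↦ f (y * h)` of a compactly supported function. -/
def mulRightLM (h : H) : C_c(H, ℝ) →ₗ[ℝ] C_c(H, ℝ) where
  toFun f := ⟨⟨fun y => f (y * h), f.continuous.comp (continuous_mul_const h)⟩,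
    f.hasCompactSupport'.comp_homeomorph (Homeomorph.mulRight h)⟩
  map_add' _ _ := rfl
  map_smul' _ _ := rfl

omit [T2Space H] [LocallyCompactSpace H] [MeasurableSpace H] [BorelSpace H] in
theorem mulRightLM_apply (h : H) (f : C_c(H, ℝ)) (y : H) : mulRightLM h f y = f (y * h) := rfl

omit [T2Space H] [LocallyCompactSpace H] [MeasurableSpace H] [BorelSpace H] in
theorem mulLeft_apply (x : H) (f : C_c(H, ℝ)) (y : H) : f.mulLeft x y = f (x * y) := rfl

/-- The inclusion of `C_c(H)` in `L¹(H)`. -/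
noncomputable def toL1LM (μ : Measure H) [IsFiniteMeasureOnCompacts μ] :
    C_c(H, ℝ) →ₗ[ℝ] (H →₁[μ] ℝ) where
  toFun f := f.integrable.toL1 f
  map_add' f g := Integrable.toL1_add f g f.integrable g.integrable
  map_smul' r f := Integrable.toL1_smul' f f.integrable r

omit [Group H] [IsTopologicalGroup H] [T2Space H] [LocallyCompactSpace H] in
theorem norm_toL1LM (μ : Measure H) [IsFiniteMeasureOnCompacts μ] (f : C_c(H, ℝ)) :
    ‖toL1LM μ f‖ = ∫ x, |f x| ∂μ :=
  L1.norm_of_fun_eq_integral_norm f.integrable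

omit [T2Space H] [LocallyCompactSpace H] in
theorem norm_toL1LM_mulLeft (μ : Measure H) [IsFiniteMeasureOnCompacts μ] [μ.IsMulLeftInvariant]
    (f : C_c(H, ℝ)) (x : H) : ‖toL1LM μ (f.mulLeft x)‖ = ‖toL1LM μ f‖ := by
  rw [norm_toL1LM, norm_toL1LM]
  exact integral_mul_left_eq_self (fun y => |f y|) x

omit [T2Space H] in
theorem continuous_toL1LM_mulLeft (μ : Measure H) [IsFiniteMeasureOnCompacts μ] (f : C_c(H, ℝ)) :
    Continuous fun x => toL1LM μ (f.mulLeft x) := by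
  rw [continuous_iff_continuousAt]
  intro x₀
  obtain ⟨s, hs, hs₀⟩ := exists_compact_mem_nhds x₀
  have h := tendsto_integral_norm_sub μ (G := fun x y => f (x * y))
    (f.continuous.comp continuous_mul) hs₀ (hs.inv.mul f.hasCompactSupport') fun x hx y hy => by
      by_contra hne
      exact hy ⟨x⁻¹, Set.inv_mem_inv.2 hx, x * y, subset_tsupport _ hne, by simp⟩
  rw [ContinuousAt, tendsto_iff_norm_sub_tendsto_zero]
  refine h.congr fun x => ?_
  rw [← map_sub, norm_toL1LM]
  rfl

omit [T2Space H] in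
theorem tendsto_toL1LM_mulRightLM (μ : Measure H) [IsFiniteMeasureOnCompacts μ] (f : C_c(H, ℝ))
    (h₀ : H) :
    Tendsto (fun h => ‖toL1LM μ (mulRightLM h f - mulRightLM h₀ f)‖) (𝓝 h₀) (𝓝 0) := by
  obtain ⟨s, hs, hs₀⟩ := exists_compact_mem_nhds h₀
  have h := tendsto_integral_norm_sub μ (G := fun x y => f (y * x))
    (f.continuous.comp (continuous_snd.mul continuous_fst)) hs₀
    (f.hasCompactSupport'.isCompact.mul hs.inv) fun x hx y hy => by
      by_contra hne
      exact hy ⟨y * x, subset_tsupport _ hne, x⁻¹, Set.inv_mem_inv.2 hx, by simp⟩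
  refine h.congr fun x => ?_
  rw [norm_toL1LM]
  rfl

/-- The function `x ↦ ℓ (f (x * ·))`, for `ℓ` in the dual of `L¹(H)`. -/
noncomputable def orbitFunction (μ : Measure H) [IsFiniteMeasureOnCompacts μ]
    [μ.IsMulLeftInvariant] (ℓ : StrongDual ℝ (H →₁[μ] ℝ)) (f : C_c(H, ℝ)) : H →ᵇ ℝ :=
  BoundedContinuousFunction.ofNormedAddCommGroup (fun x => ℓ (toL1LM μ (f.mulLeft x)))
    (ℓ.continuous.comp (continuous_toL1LM_mulLeft μ f)) (‖ℓ‖ * ‖toL1LM μ f‖) fun x =>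
    (ℓ.le_opNorm _).trans_eq (by rw [norm_toL1LM_mulLeft])

omit [T2Space H] in
theorem orbitFunction_apply (μ : Measure H) [IsFiniteMeasureOnCompacts μ]
    [μ.IsMulLeftInvariant] (ℓ : StrongDual ℝ (H →₁[μ] ℝ)) (f : C_c(H, ℝ)) (x : H) :
    orbitFunction μ ℓ f x = ℓ (toL1LM μ (f.mulLeft x)) := rfl

omit [T2Space H] in
theorem exists_density (μ : Measure H) [μ.IsHaarMeasure] :
    ∃ f : C_c(H, ℝ), (∀ x, 0 ≤ f x) ∧ ∫ x, f x ∂μ = 1 := by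
  obtain ⟨g, hg, hg0, hg1⟩ := exists_continuous_nonneg_pos (1 : H)
  have hpos : 0 < ∫ x, g x ∂μ :=
    g.continuous.integral_pos_of_hasCompactSupport_nonneg_nonzero hg hg0 hg1
  let f : C_c(H, ℝ) := ⟨g, hg⟩
  refine ⟨(∫ x, g x ∂μ)⁻¹ • f, fun x => ?_, ?_⟩
  · exact mul_nonneg (inv_nonneg.2 hpos.le) (hg0 x)
  · exact (integral_const_mul _ _).trans (inv_mul_cancel₀ hpos.ne')

end CompactlySupportedContinuousMap

omit [Group H] [IsTopologicalGroup H] [T2Space H] [LocallyCompactSpace H]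
  [MeasurableSpace H] [BorelSpace H] in
theorem le_mean_of_forall_le {m : (H →ᵇ ℝ) →ₗ[ℝ] ℝ} (hpos : ∀ f : H →ᵇ ℝ, (∀ x, 0 ≤ f x) → 0 ≤ m f)
    (hone : m (BoundedContinuousFunction.const H 1) = 1) {f : H →ᵇ ℝ} {a : ℝ}
    (hf : ∀ x, a ≤ f x) : a ≤ m f := by
  have h := hpos (f - a • BoundedContinuousFunction.const H 1) fun x => by
    simpa using hf x
  rw [map_sub, map_smul, hone, smul_eq_mul, mul_one] at h
  linarith

open CompactlySupportedContinuousMap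

/-- A left invariant mean annihilates the orbit functions of functions of integral zero. -/
theorem mean_orbitFunction_eq_zero (μ : Measure H) [μ.IsHaarMeasure]
    {m : (H →ᵇ ℝ) →ₗ[ℝ] ℝ} (hpos : ∀ f : H →ᵇ ℝ, (∀ x, 0 ≤ f x) → 0 ≤ m f)
    (hone : m (BoundedContinuousFunction.const H 1) = 1)
    (hinv : ∀ (g : H) (f : H →ᵇ ℝ),
      m (f.compContinuous ⟨fun x => g * x, continuous_const_mul g⟩) = m f)
    (ℓ : StrongDual ℝ (H →₁[μ] ℝ)) (f : C_c(H, ℝ)) (hf : ∫ x, f x ∂μ = 0) :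
    m (orbitFunction μ ℓ f) = 0 := by
  let J : C_c(H, ℝ) →ₗ[ℝ] ℝ :=
    { toFun := fun φ => m (orbitFunction μ ℓ φ)
      map_add' := fun φ φ' => by
        rw [← map_add]
        congr 1
        ext x
        exact (congrArg ℓ (map_add (toL1LM μ) (φ.mulLeft x) (φ'.mulLeft x))).trans (map_add ℓ _ _)
      map_smul' := fun r φ => by
        rw [← map_smul]
        congr 1
        ext x
        exact (congrArg ℓ (map_smul (toL1LM μ) r (φ.mulLeft x))).trans (map_smul ℓ r _) }
  have hJ : ∀ φ, |J φ| ≤ ‖ℓ‖ * ∫ x, |φ x| ∂μ := by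
    intro φ
    have hb : ∀ x, |orbitFunction μ ℓ φ x| ≤ ‖ℓ‖ * ∫ x, |φ x| ∂μ := fun x =>
      (ℓ.le_opNorm _).trans_eq (by rw [norm_toL1LM_mulLeft, norm_toL1LM])
    have h1 := le_mean_of_forall_le hpos hone fun x => neg_le_of_abs_le (hb x)
    have h2 := le_mean_of_forall_le hpos hone (f := -orbitFunction μ ℓ φ)
      fun x => neg_le_neg (le_of_abs_le (hb x))
    rw [map_neg] at h2
    exact abs_le.2 ⟨h1, neg_le_neg_iff.1 h2⟩
  -- Translating `φ` by `g` translates its orbit function by `g`, so invariance of the mean makes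
  -- `J` left invariant.
  obtain ⟨d, hd⟩ := exists_eq_mul_integral_of_mulLeft μ J ‖ℓ‖ hJ fun g φ => by
    refine Eq.trans ?_ (hinv g (orbitFunction μ ℓ φ))
    refine congrArg m (BoundedContinuousFunction.ext fun x => ?_)
    have : (φ.mulLeft g).mulLeft x = φ.mulLeft (g * x) := by
      ext y
      simp only [mulLeft_apply, mul_assoc]
    exact congrArg (fun φ => ℓ (toL1LM μ φ)) this
  exact (hd f).trans (by rw [hf, mul_zero])

/-- **Reiter's condition** for amenable unimodular groups: there are densities which are
almost invariant in `L¹` under right translations, uniformly on a compact set. -/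
theorem IsAmenableGroup.exists_almost_invariant_density (hH : IsAmenableGroup H)
    (μ : Measure H) [μ.IsHaarMeasure] [μ.IsMulRightInvariant] {K : Set H} (hK : IsCompact K)
    {ε : ℝ} (hε : 0 < ε) :
    ∃ p : C_c(H, ℝ), (∀ x, 0 ≤ p x) ∧ ∫ x, p x ∂μ = 1 ∧
      ∀ h ∈ K, ∫ y, |p (y * h) - p y| ∂μ ≤ ε := by
  obtain ⟨m, hpos, hone, hinv⟩ := hH
  obtain ⟨γ, hγ0, hγ1⟩ := exists_density μ
  obtain ⟨t, -, htK⟩ := hK.elim_nhds_subcover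
    (fun h₀ => {h | ‖toL1LM μ (mulRightLM h γ - mulRightLM h₀ γ)‖ < ε / 2}) fun h₀ _ =>
      (tendsto_toL1LM_mulRightLM μ γ h₀).eventually_lt_const (half_pos hε)
  -- The last condition lets every candidate inherit the modulus of continuity of `γ`, so near
  -- invariance on the finite set `t` spreads to `K`. It survives convex combinations, and left
  -- translates of `γ` satisfy it because left and right translations commute.
  let P : Set C_c(H, ℝ) := {p | (∀ x, 0 ≤ p x) ∧ ∫ x, p x ∂μ = 1 ∧ ∀ h h₀ : H,
    ‖toL1LM μ (mulRightLM h p - mulRightLM h₀ p)‖ ≤ ‖toL1LM μ (mulRightLM h γ - mulRightLM h₀ γ)‖}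
  have hP : Convex ℝ P := by
    intro p hp q hq a b ha hb hab
    refine ⟨fun x => ?_, ?_, fun h h₀ => ?_⟩
    · exact add_nonneg (mul_nonneg ha (hp.1 x)) (mul_nonneg hb (hq.1 x))
    · change ∫ x, (a * p x + b * q x) ∂μ = 1
      rw [integral_add (p.integrable.const_mul a) (q.integrable.const_mul b), integral_const_mul,
        integral_const_mul, hp.2.1, hq.2.1, mul_one, mul_one, hab]
    · have e : toL1LM μ (mulRightLM h (a • p + b • q) - mulRightLM h₀ (a • p + b • q))
          = a • toL1LM μ (mulRightLM h p - mulRightLM h₀ p)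
            + b • toL1LM μ (mulRightLM h q - mulRightLM h₀ q) := by
        simp only [map_add, map_sub, map_smul, smul_sub]
        abel
      rw [e]
      refine (norm_add_le _ _).trans ?_
      rw [norm_smul, norm_smul, Real.norm_of_nonneg ha, Real.norm_of_nonneg hb]
      refine (add_le_add (mul_le_mul_of_nonneg_left (hp.2.2 h h₀) ha)
        (mul_le_mul_of_nonneg_left (hq.2.2 h h₀) hb)).trans_eq ?_
      rw [← add_mul, hab, one_mul]
  have hcomm : ∀ (x h : H) (φ : C_c(H, ℝ)),
      mulRightLM h (φ.mulLeft x) = (mulRightLM h φ).mulLeft x := by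
    intro x h φ
    ext y
    simp only [mulRightLM_apply, mulLeft_apply, mul_assoc]
  have hγP : ∀ x, γ.mulLeft x ∈ P := by
    intro x
    refine ⟨fun y => hγ0 _, (integral_mul_left_eq_self γ x).trans hγ1, fun h h₀ => ?_⟩
    rw [hcomm, hcomm]
    exact (norm_toL1LM_mulLeft μ (mulRightLM h γ - mulRightLM h₀ γ) x).le
  let D : C_c(H, ℝ) →ₗ[ℝ] (t → (H →₁[μ] ℝ)) :=
    LinearMap.pi fun h => toL1LM μ ∘ₗ (mulRightLM h.1 - LinearMap.id)
  -- Otherwise a functional separates `0` from `D '' P` by some `u > 0`. On the left translates of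
  -- `γ` it is a sum `S ≥ u` of orbit functions of functions of integral zero, so the mean of `S`
  -- would be both at least `u` and zero.
  have hD : (0 : t → (H →₁[μ] ℝ)) ∈ closure (D '' P) := by
    by_contra h0
    obtain ⟨f, u, hu, hf⟩ := geometric_hahn_banach_point_closed
      (hP.linear_image D).closure isClosed_closure h0
    rw [map_zero] at hu
    classical
    let ℓ : t → StrongDual ℝ (H →₁[μ] ℝ) := fun h =>
      f ∘L ContinuousLinearMap.single ℝ (fun _ : t => (H →₁[μ] ℝ)) h
    let S : H →ᵇ ℝ := ∑ h : t, orbitFunction μ (ℓ h) (mulRightLM h.1 γ - γ)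
    have hS : ∀ x, S x = f (D (γ.mulLeft x)) := by
      intro x
      rw [BoundedContinuousFunction.sum_apply]
      conv_rhs => rw [← Finset.univ_sum_single (D (γ.mulLeft x)), map_sum]
      refine Finset.sum_congr rfl fun h _ => ?_
      rw [orbitFunction_apply]
      have : (mulRightLM h.1 γ - γ).mulLeft x = mulRightLM h.1 (γ.mulLeft x) - γ.mulLeft x := by
        rw [hcomm]; rfl
      rw [this]
      rfl
    have h1 : u ≤ m S := le_mean_of_forall_le hpos hone fun x => by
      rw [hS]
      exact (hf _ (subset_closure ⟨_, hγP x, rfl⟩)).le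
    have h2 : m S = 0 := by
      rw [map_sum]
      refine Finset.sum_eq_zero fun h _ =>
        mean_orbitFunction_eq_zero μ hpos hone hinv (ℓ h) _ ?_
      change ∫ x, (mulRightLM h.1 γ x - γ x) ∂μ = 0
      rw [integral_sub (mulRightLM h.1 γ).integrable γ.integrable]
      exact sub_eq_zero.2 (integral_mul_right_eq_self γ h.1)
    exact absurd (hu.trans_le h1) (by rw [h2]; exact lt_irrefl _)
  obtain ⟨_, ⟨p, hp, rfl⟩, hdist⟩ := Metric.mem_closure_iff.1 hD (ε / 2) (half_pos hε)
  refine ⟨p, hp.1, hp.2.1, fun h hh => ?_⟩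
  obtain ⟨h₀, hh₀, hlt⟩ := Set.mem_iUnion₂.1 (htK hh)
  have h3 : ‖toL1LM μ (mulRightLM h₀ p - p)‖ < ε / 2 := by
    rw [dist_zero_left] at hdist
    exact (norm_le_pi_norm (D p) ⟨h₀, hh₀⟩).trans_lt hdist
  have h4 := (hp.2.2 h h₀).trans_lt hlt
  have e : toL1LM μ (mulRightLM h p - p)
      = toL1LM μ (mulRightLM h p - mulRightLM h₀ p) + toL1LM μ (mulRightLM h₀ p - p) := by
    rw [← map_add, sub_add_sub_cancel]
  have h5 : ∫ y, |p (y * h) - p y| ∂μ = ‖toL1LM μ (mulRightLM h p - p)‖ :=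
    (norm_toL1LM μ (mulRightLM h p - p)).symm
  rw [h5, e]
  exact ((norm_add_le _ _).trans (add_le_add h4.le h3.le)).trans_eq (add_halves ε)

end Reiter

/-! ### Integrals of functions of positive type. -/

section PositiveType

variable {H : Type*} [Group H] [TopologicalSpace H] [IsTopologicalGroup H] [T2Space H]
  [MeasurableSpace H] [BorelSpace H]

-- Expanding, `‖W l - W k‖² = 2 Re Φ(1) - 2 Re Φ(l⁻¹k)`, which tends to 0 as `l → k`. This matters
-- because `π` is not assumed continuous.
omit [T2Space H] [MeasurableSpace H] [BorelSpace H] in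
theorem continuous_of_inner_eq {X : Type*} [NormedAddCommGroup X] [InnerProductSpace ℂ X]
    {W : H → X} {Φ : H → ℂ} (hΦ : Continuous Φ)
    (hW : ∀ k l, inner ℂ (W k) (W l) = Φ (k⁻¹ * l)) : Continuous W := by
  rw [continuous_iff_continuousAt]
  intro k
  rw [ContinuousAt, tendsto_iff_norm_sub_tendsto_zero]
  have h : ∀ l, ‖W l - W k‖ = √(2 * (Φ 1).re - 2 * (Φ (l⁻¹ * k)).re) := by
    intro l
    have e : ‖W l - W k‖ ^ 2 = 2 * (Φ 1).re - 2 * (Φ (l⁻¹ * k)).re := by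
      have hl := inner_self_eq_norm_sq (𝕜 := ℂ) (W l)
      have hk := inner_self_eq_norm_sq (𝕜 := ℂ) (W k)
      rw [hW, inv_mul_cancel] at hl hk
      rw [norm_sub_sq (𝕜 := ℂ), hW, ← hl, ← hk]
      simp only [RCLike.re_eq_complex_re]
      ring
    rw [← e, Real.sqrt_sq (norm_nonneg _)]
  simp only [h]
  have hc : Continuous fun l => √(2 * (Φ 1).re - 2 * (Φ (l⁻¹ * k)).re) := by fun_prop
  simpa using hc.tendsto k

omit [T2Space H] in
/-- A continuous function of positive type has nonnegative pairing with `ξ * ξ^*`. -/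
theorem re_integral_mul_correlation_nonneg (μ : Measure H) [IsFiniteMeasureOnCompacts μ]
    [μ.IsMulLeftInvariant] {X : Type*} [NormedAddCommGroup X] [InnerProductSpace ℂ X]
    {W : H → X} {Φ : H → ℂ} (hΦ : Continuous Φ) (hc : HasCompactSupport Φ)
    (hW : ∀ k l, inner ℂ (W k) (W l) = Φ (k⁻¹ * l)) (ξ : C_c(H, ℝ)) :
    0 ≤ (∫ h, Φ h * (∫ k, ξ k * ξ (k * h) ∂μ : ℝ) ∂μ).re := by
  -- The pairing is, up to conjugation, `‖∫ ξ(k)W(k) dk‖²`. The vector integral needs a complete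
  -- space, and `X` will be an algebraic tensor product.
  let f : H → UniformSpace.Completion X := fun k => (ξ k : ℂ) • (W k : UniformSpace.Completion X)
  have hf : Continuous f :=
    (Complex.continuous_ofReal.comp ξ.continuous).smul
      ((UniformSpace.Completion.continuous_coe X).comp (continuous_of_inner_eq hΦ hW))
  have hfc : HasCompactSupport f :=
    (ξ.hasCompactSupport'.comp_left (g := ((↑) : ℝ → ℂ)) Complex.ofReal_zero).smul_right
  have hfi : Integrable f μ := hf.integrable_of_hasCompactSupport hfc
  have hff : ∀ l k, inner ℂ (f l) (f k) = ξ l * ξ k * Φ (l⁻¹ * k) := by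
    intro l k
    simp only [f, inner_smul_left, inner_smul_right, UniformSpace.Completion.inner_coe, hW,
      Complex.conj_ofReal]
    ring
  have h0 : 0 ≤ (inner ℂ (∫ k, f k ∂μ) (∫ k, f k ∂μ)).re := inner_self_nonneg (𝕜 := ℂ)
  refine h0.trans_eq ?_
  have h1 : inner ℂ (∫ k, f k ∂μ) (∫ k, f k ∂μ)
      = (starRingEnd ℂ) (∫ l, ∫ k, (ξ l * ξ k * Φ (l⁻¹ * k) : ℂ) ∂μ ∂μ) := by
    rw [← integral_inner hfi, ← integral_conj]
    refine integral_congr_ae (Eventually.of_forall fun l => ?_)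
    change inner ℂ (∫ k, f k ∂μ) (f l) = _
    rw [← inner_conj_symm, ← integral_inner hfi]
    simp only [hff]
  have h2 : ∀ l, ∫ k, (ξ l * ξ k * Φ (l⁻¹ * k) : ℂ) ∂μ = ∫ h, (ξ l * ξ (l * h) * Φ h : ℂ) ∂μ := by
    intro l
    rw [← integral_mul_left_eq_self _ l]
    simp only [inv_mul_cancel_left]
  have h3 : ∫ l, ∫ h, (ξ l * ξ (l * h) * Φ h : ℂ) ∂μ ∂μ
      = ∫ h, ∫ l, (ξ l * ξ (l * h) * Φ h : ℂ) ∂μ ∂μ := by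
    have hξ := ξ.continuous
    refine integral_integral_swap_of_hasCompactSupport
      (f := fun l h => (ξ l * ξ (l * h) * Φ h : ℂ)) ?_ ?_
    · exact ((Complex.continuous_ofReal.comp (hξ.comp continuous_fst)).mul
        (Complex.continuous_ofReal.comp (hξ.comp continuous_mul))).mul (hΦ.comp continuous_snd)
    · refine HasCompactSupport.intro (ξ.hasCompactSupport'.isCompact.prod hc.isCompact) ?_
      rintro ⟨l, h⟩ hlh
      by_contra hne
      refine hlh ⟨subset_tsupport _ fun h0 => hne ?_, subset_tsupport _ fun h0 => hne ?_⟩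
      · change ξ l = 0 at h0
        simp [h0]
      · change Φ h = 0 at h0
        simp [h0]
  rw [h1, Complex.conj_re]
  simp only [h2]
  rw [h3]
  congr 1
  refine integral_congr_ae (Eventually.of_forall fun h => ?_)
  change ∫ l, (ξ l * ξ (l * h) * Φ h : ℂ) ∂μ = _
  rw [integral_mul_const, mul_comm]
  simp only [← integral_complex_ofReal, Complex.ofReal_mul]

theorem sq_sqrt_sub_sqrt_le {a b : ℝ} (ha : 0 ≤ a) (hb : 0 ≤ b) : (√a - √b) ^ 2 ≤ |a - b| := by
  have h : a - b = (√a - √b) * (√a + √b) := by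
    nlinarith [Real.mul_self_sqrt ha, Real.mul_self_sqrt hb]
  rw [h, abs_mul, ← sq_abs, sq]
  refine mul_le_mul_of_nonneg_left ?_ (abs_nonneg _)
  rw [abs_of_nonneg (add_nonneg (Real.sqrt_nonneg a) (Real.sqrt_nonneg b)), abs_le]
  constructor <;> linarith [Real.sqrt_nonneg a, Real.sqrt_nonneg b]

omit [T2Space H] in
/-- The square root of a density has correlation close to one where the density is almost
invariant. -/
theorem abs_one_sub_correlation_le (μ : Measure H) [IsFiniteMeasureOnCompacts μ]
    [μ.IsMulRightInvariant] {p ξ : C_c(H, ℝ)} (hp0 : ∀ x, 0 ≤ p x) (hξ : ∀ x, ξ x = √(p x))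
    (hp1 : ∫ x, p x ∂μ = 1) (h : H) :
    |1 - ∫ k, ξ k * ξ (k * h) ∂μ| ≤ ∫ y, |p (y * h) - p y| ∂μ := by
  let ph : C_c(H, ℝ) := CompactlySupportedContinuousMap.mulRightLM h p
  let ξh : C_c(H, ℝ) := CompactlySupportedContinuousMap.mulRightLM h ξ
  have hph : ∫ x, ph x ∂μ = 1 := (integral_mul_right_eq_self p h).trans hp1
  have hsq : ∀ x, (ξh x - ξ x) ^ 2 = ph x + p x - 2 * (ξ * ξh) x := by
    intro x
    have h1 : ξ x * ξ x = p x := by rw [hξ]; exact Real.mul_self_sqrt (hp0 x)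
    have h2 : ξh x * ξh x = ph x := by
      change ξ (x * h) * ξ (x * h) = p (x * h)
      rw [hξ]; exact Real.mul_self_sqrt (hp0 _)
    change _ = ph x + p x - 2 * (ξ x * ξh x)
    rw [← h1, ← h2]; ring
  -- Both square roots are unit vectors in `L²`, so one minus the correlation is half their squared
  -- distance.
  have hint : ∫ x, (ξh x - ξ x) ^ 2 ∂μ = 2 - 2 * ∫ x, (ξ * ξh) x ∂μ := by
    have hi : Integrable (fun x => ph x + p x) μ := ph.integrable.add p.integrable
    simp only [hsq]
    rw [integral_sub hi ((ξ * ξh).integrable.const_mul 2),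
      integral_add ph.integrable p.integrable, hph, hp1, integral_const_mul]
    norm_num
  have h0 : 0 ≤ ∫ x, (ξh x - ξ x) ^ 2 ∂μ := integral_nonneg fun x => sq_nonneg _
  have hle : ∫ x, (ξh x - ξ x) ^ 2 ∂μ ≤ ∫ y, |p (y * h) - p y| ∂μ := by
    refine integral_mono ?_ (ph - p).integrable.abs fun x => ?_
    · simp only [hsq]
      exact (ph.integrable.add p.integrable).sub ((ξ * ξh).integrable.const_mul 2)
    · change (ξ (x * h) - ξ x) ^ 2 ≤ |p (x * h) - p x|
      rw [hξ, hξ]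
      exact sq_sqrt_sub_sqrt_le (hp0 _) (hp0 _)
  change |1 - ∫ k, (ξ * ξh) k ∂μ| ≤ _
  rw [abs_of_nonneg] <;> linarith

/-- On an amenable unimodular group, a continuous function of positive type with compact support
has nonnegative integral. -/
theorem IsAmenableGroup.re_integral_nonneg [LocallyCompactSpace H] (hH : IsAmenableGroup H)
    (μ : Measure H) [μ.IsHaarMeasure] [μ.IsMulRightInvariant]
    {X : Type*} [NormedAddCommGroup X] [InnerProductSpace ℂ X]
    {W : H → X} {Φ : H → ℂ} (hΦ : Continuous Φ) (hc : HasCompactSupport Φ)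
    (hW : ∀ k l, inner ℂ (W k) (W l) = Φ (k⁻¹ * l)) :
    0 ≤ (∫ h, Φ h ∂μ).re := by
  have key : ∀ ε : ℝ, 0 < ε → -(ε * ∫ h, ‖Φ h‖ ∂μ) ≤ (∫ h, Φ h ∂μ).re := by
    intro ε hε
    obtain ⟨p, hp0, hp1, hpK⟩ := hH.exists_almost_invariant_density μ hc.isCompact hε
    let ξ : C_c(H, ℝ) := ⟨⟨fun x => √(p x), Real.continuous_sqrt.comp p.continuous⟩,
      p.hasCompactSupport'.comp_left (g := Real.sqrt) Real.sqrt_zero⟩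
    have hξ : ∀ x, ξ x = √(p x) := fun _ => rfl
    have h1 := re_integral_mul_correlation_nonneg μ hΦ hc hW ξ
    have hΦi : Integrable Φ μ := hΦ.integrable_of_hasCompactSupport hc
    set A : H → ℝ := fun h => ∫ k, ξ k * ξ (k * h) ∂μ with hA
    have hAc : Continuous A := by
      rw [← continuousOn_univ]
      refine continuousOn_integral_of_compact_support (k := tsupport ξ)
        ξ.hasCompactSupport'.isCompact ?_ fun p x _ hx => ?_
      · exact ((ξ.continuous.comp continuous_snd).mul
          (ξ.continuous.comp (continuous_snd.mul continuous_fst))).continuousOn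
      · simp [image_eq_zero_of_notMem_tsupport hx]
    have hAi : Integrable (fun h => Φ h * (A h : ℂ)) μ :=
      (hΦ.mul (Complex.continuous_ofReal.comp hAc)).integrable_of_hasCompactSupport hc.mul_right
    have h2 : ‖∫ h, (Φ h - Φ h * (A h : ℂ)) ∂μ‖ ≤ ε * ∫ h, ‖Φ h‖ ∂μ := by
      rw [← integral_const_mul]
      refine norm_integral_le_of_norm_le (hΦi.norm.const_mul ε) (Eventually.of_forall fun h => ?_)
      have e : Φ h - Φ h * (A h : ℂ) = ((1 - A h : ℝ) : ℂ) * Φ h := by push_cast; ring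
      rw [e, norm_mul, Complex.norm_real]
      by_cases hh : h ∈ tsupport Φ
      · exact mul_le_mul_of_nonneg_right
          ((abs_one_sub_correlation_le μ hp0 hξ hp1 h).trans (hpK h hh)) (norm_nonneg _)
      · simp [image_eq_zero_of_notMem_tsupport hh]
    rw [integral_sub hΦi hAi] at h2
    have h3 := (abs_le.1 ((Complex.abs_re_le_norm _).trans h2)).1
    rw [Complex.sub_re] at h3
    linarith
  set a := ∫ h, ‖Φ h‖ ∂μ
  have ha : 0 ≤ a := integral_nonneg fun _ => norm_nonneg _
  by_contra! hneg
  -- This `ε` makes `ε a` at most half of `-Re ∫ Φ`, contradicting the estimate; the `+ 1` covers `a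
  -- = 0`.
  have h := key (-(∫ h, Φ h ∂μ).re / (2 * (a + 1))) (by apply div_pos <;> linarith)
  have h' : -(∫ h, Φ h ∂μ).re / (2 * (a + 1)) * a ≤ -(∫ h, Φ h ∂μ).re / 2 := by
    rw [div_mul_eq_mul_div, div_le_div_iff₀ (by linarith) (by norm_num)]
    nlinarith
  linarith

end PositiveType

noncomputable section

/-! ### Twisted left translations. -/

section Translation

variable {H : Type*} [Group H] [TopologicalSpace H] [IsTopologicalGroup H]
  [MeasurableSpace H] {c : GroupMultiplier H} {μ : Measure H}

/-- The twisted left translation `(U_k f)(h) = c(k, k⁻¹ h) f(k⁻¹ h)` on `C_c(H, c)`. -/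
def TwistedCc.twistedTranslate (k : H) (f : TwistedCc c μ) : TwistedCc c μ :=
  TwistedCc.mk (fun h => (c k (k⁻¹ * h) : ℂ) * f (k⁻¹ * h))
    ((c.continuous_comp continuous_const (continuous_const_mul _)).mul
      (f.continuous.comp (continuous_const_mul _)))
    ((f.hasCompactSupport.comp_homeomorph (Homeomorph.mulLeft k⁻¹)).mul_left)

namespace TwistedCc

theorem twistedTranslate_apply (k : H) (f : TwistedCc c μ) (h : H) :
    twistedTranslate k f h = (c k (k⁻¹ * h) : ℂ) * f (k⁻¹ * h) := rfl

theorem twistedTranslate_twistedTranslate (k m : H) (f : TwistedCc c μ) :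
    twistedTranslate k (twistedTranslate m f) = (c k m : ℂ) • twistedTranslate (k * m) f := by
  ext h
  simp only [twistedTranslate_apply, smul_apply]
  have h1 := c.cocycle k m ((k * m)⁻¹ * h)
  have e1 : m⁻¹ * (k⁻¹ * h) = (k * m)⁻¹ * h := by group
  have e2 : m * ((k * m)⁻¹ * h) = k⁻¹ * h := by group
  rw [e2] at h1
  have h2 := congrArg (fun z : Circle => (z : ℂ)) h1
  simp only [Circle.coe_mul] at h2
  rw [e1]
  linear_combination -(f ((k * m)⁻¹ * h)) * h2

theorem continuous_translate_uncurry (f : TwistedCc c μ) :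
    Continuous fun p : H × H => twistedTranslate p.1 f p.2 :=
  (c.continuous_comp continuous_fst (by fun_prop)).mul (f.continuous.comp (by fun_prop))

theorem twistedTranslate_eq_zero {f : TwistedCc c μ} {k h : H} (hh : k⁻¹ * h ∉ tsupport f) :
    twistedTranslate k f h = 0 := by
  rw [twistedTranslate_apply, image_eq_zero_of_notMem_tsupport hh, mul_zero]

variable [BorelSpace H] [T2Space H]

/-- Twisted translations act as unitaries for the form `(f, g) ↦ f^* * g`: after `z ↦ kz` only
phases differ, and the cocycle identity cancels them. -/
theorem star_translate_mul_translate [IsFiniteMeasureOnCompacts μ] [μ.IsMulLeftInvariant]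
    (k : H) (f g : TwistedCc c μ) :
    star (twistedTranslate k f) * twistedTranslate k g = star f * g := by
  ext h
  rw [mul_apply, mul_apply, ← integral_mul_left_eq_self _ k]
  refine integral_congr_ae (Eventually.of_forall fun z => ?_)
  simp only [star_apply, twistedTranslate_apply, map_mul, inv_mul_cancel_left]
  have e1 : k⁻¹ * (h * (k * z)⁻¹)⁻¹ = (h * z⁻¹)⁻¹ := by group
  have e2 : h * (k * z)⁻¹ = (h * z⁻¹) * k⁻¹ := by group
  rw [e1, e2]
  generalize h * z⁻¹ = a
  have h1 := c.starFactor_mul a k⁻¹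
  have h2 := c.cocycle a k⁻¹ (k * z)
  have h3 := c.cocycle k⁻¹ k z
  rw [inv_mul_cancel_left] at h2
  rw [inv_mul_cancel, c.one_left] at h3
  have h4 : c.starFactor k⁻¹ * (c k⁻¹ k * c 1 1) = 1 := by
    rw [GroupMultiplier.starFactor, inv_inv, mul_comm (c k⁻¹ k), ← mul_inv, inv_mul_cancel]
  rw [h3] at h4
  rw [inv_inv] at h1
  have key : c.starFactor (a * k⁻¹) * (c k a⁻¹)⁻¹ * c k z * c (a * k⁻¹) (k * z)
      = c.starFactor a * c a z := by
    calc _ = c.starFactor a * c.starFactor k⁻¹ * c k z * (c a k⁻¹ * c (a * k⁻¹) (k * z)) := by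
          rw [h1]; simp only [mul_assoc, mul_left_comm]
      _ = c.starFactor a * c a z * (c.starFactor k⁻¹ * (c k⁻¹ (k * z) * c k z)) := by
          rw [h2]; ac_rfl
      _ = _ := by rw [h4, mul_one]
  have key' := congrArg (fun z : Circle => (z : ℂ)) key
  simp only [Circle.coe_mul, Circle.coe_inv_eq_conj] at key'
  linear_combination ((starRingEnd ℂ) (f a⁻¹) * g z) * key'

variable [LocallyCompactSpace H]

/-- Substitute `k ↦ k⁻¹`, where unimodularity enters, and then `k ↦ h⁻¹k`. -/
theorem mul_apply_eq_integral_translate [μ.IsHaarMeasure] [μ.Regular] [μ.IsMulRightInvariant]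
    (f g : TwistedCc c μ) (h : H) : (f * g) h = ∫ k, f k * twistedTranslate k g h ∂μ := by
  have := isInvInvariant_of_isMulRightInvariant μ
  rw [mul_apply, ← integral_inv_eq_self, ← integral_mul_left_eq_self _ h⁻¹]
  refine integral_congr_ae (Eventually.of_forall fun k => ?_)
  simp only [twistedTranslate_apply, mul_inv_rev, inv_inv, mul_inv_cancel_left]
  ring

/-- An `L¹`-bounded functional on `C_c(H, c)` commutes with the integral defining the product. -/
theorem map_mul_eq_integral_translate [μ.IsHaarMeasure] [μ.Regular] [μ.IsMulRightInvariant]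
    (Λ : TwistedCc c μ →ₗ[ℂ] ℂ) (C : ℝ) (hΛ : ∀ f, ‖Λ f‖ ≤ C * ∫ x, ‖f x‖ ∂μ)
    (f g : TwistedCc c μ) : Λ (f * g) = ∫ k, f k * Λ (twistedTranslate k g) ∂μ := by
  have h := map_integral_of_norm_le_integral μ μ (X := H) (Y := H) Λ C hΛ
    (fun k => f k • twistedTranslate k g) ?_ ?_ (f * g) (mul_apply_eq_integral_translate f g)
  · refine h.trans (integral_congr_ae (Eventually.of_forall fun k => ?_))
    exact map_smul Λ (f k) (twistedTranslate k g)
  · exact (f.continuous.comp continuous_fst).mul g.continuous_translate_uncurry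
  · refine HasCompactSupport.intro (K := tsupport f ×ˢ (tsupport f * tsupport g))
      (f.hasCompactSupport.isCompact.prod
        (f.hasCompactSupport.isCompact.mul g.hasCompactSupport.isCompact)) ?_
    rintro ⟨k, x⟩ hkx
    change f k * twistedTranslate k g x = 0
    by_cases hk : k ∈ tsupport f
    · by_cases hx : k⁻¹ * x ∈ tsupport g
      · exact absurd ⟨hk, k, hk, _, hx, by simp⟩ hkx
      · rw [twistedTranslate_eq_zero hx, mul_zero]
    · rw [image_eq_zero_of_notMem_tsupport hk, zero_mul]

end TwistedCc

end Translation

/-! ### Covariance in representations and cancellation of the cocycles. -/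

section Representation

variable {H : Type*} [Group H] [TopologicalSpace H] [IsTopologicalGroup H] [T2Space H]
  [LocallyCompactSpace H] [MeasurableSpace H] [BorelSpace H] {c : GroupMultiplier H}
  {μ : Measure H}

open TwistedCc

theorem TwistedRep.continuous_translate [IsFiniteMeasureOnCompacts μ] [μ.IsMulRightInvariant]
    (ρ : TwistedRep c μ) (f : TwistedCc c μ) :
    Continuous fun k => ρ.rep (twistedTranslate k f) := by
  rw [continuous_iff_continuousAt]
  intro k₀
  obtain ⟨s, hs, hs₀⟩ := exists_compact_mem_nhds k₀
  have h := tendsto_integral_norm_sub μ (G := fun k x => twistedTranslate k f x)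
    f.continuous_translate_uncurry hs₀ (hs.mul f.hasCompactSupport.isCompact)
    fun k hk x hx => twistedTranslate_eq_zero fun hmem => hx ⟨k, hk, _, hmem, by simp⟩
  rw [ContinuousAt, tendsto_iff_norm_sub_tendsto_zero]
  refine squeeze_zero (fun _ => norm_nonneg _) (fun k => ?_) h
  rw [← map_sub]
  exact ρ.norm_rep_le _

/-- The weak form of `ρ(f * g) = ∫ f(k) ρ(U_k g) dk`: matrix coefficients of `ρ` are `L¹`-bounded by
contractivity. -/
theorem TwistedRep.inner_rep_mul [μ.IsHaarMeasure] [μ.Regular] [μ.IsMulRightInvariant]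
    (ρ : TwistedRep c μ) (f g : TwistedCc c μ) (η ζ : ρ.space) :
    inner ℂ η (ρ.rep (f * g) ζ) = ∫ k, f k * inner ℂ η (ρ.rep (twistedTranslate k g) ζ) ∂μ := by
  let Λ : TwistedCc c μ →ₗ[ℂ] ℂ :=
    { toFun := fun f => inner ℂ η (ρ.rep f ζ)
      map_add' := fun f g => by rw [map_add, _root_.add_apply, inner_add_right]
      map_smul' := fun z f => by
        rw [map_smul, _root_.smul_apply, inner_smul_right]; rfl }
  refine map_mul_eq_integral_translate Λ (‖η‖ * ‖ζ‖) (fun f => ?_) f g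
  refine (norm_inner_le_norm _ _).trans ?_
  rw [mul_assoc]
  refine mul_le_mul_of_nonneg_left ?_ (norm_nonneg _)
  rw [mul_comm]
  exact ((ρ.rep f).le_opNorm ζ).trans
    (mul_le_mul_of_nonneg_right (ρ.norm_rep_le f) (norm_nonneg _))

omit [LocallyCompactSpace H] in
theorem TwistedRep.inner_rep_rep [IsFiniteMeasureOnCompacts μ] [μ.IsMulRightInvariant]
    (ρ : TwistedRep c μ) (f g : TwistedCc c μ) (η ζ : ρ.space) :
    inner ℂ (ρ.rep f η) (ρ.rep g ζ) = inner ℂ η (ρ.rep (star f * g) ζ) := by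
  rw [map_mul, map_star, ContinuousLinearMap.star_eq_adjoint, mul_apply_eq_comp,
    ContinuousLinearMap.adjoint_inner_right]

-- Follows from `U_k U_m = c(k, m) U_{km}` and invariance of `f^* * f` under `U_k`. The phase is the
-- one cancelled by `ProjectiveUnitaryRep.inner_apply_apply`.
omit [LocallyCompactSpace H] in
theorem TwistedRep.inner_translate [μ.IsHaarMeasure] [μ.IsMulRightInvariant]
    (ρ : TwistedRep c μ) (f : TwistedCc c μ) (k m : H) (ζ : ρ.space) :
    (c k m : ℂ) * inner ℂ (ρ.rep (twistedTranslate k f) ζ) (ρ.rep (twistedTranslate (k * m) f) ζ)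
      = inner ℂ (ρ.rep f ζ) (ρ.rep (twistedTranslate m f) ζ) := by
  rw [← inner_smul_right, ← _root_.smul_apply, ← map_smul, ← twistedTranslate_twistedTranslate,
    inner_rep_rep, star_translate_mul_translate, ← inner_rep_rep]

variable {E : Type*} [NormedAddCommGroup E] [InnerProductSpace ℂ E] [CompleteSpace E]

omit [IsTopologicalGroup H] [T2Space H] [LocallyCompactSpace H] [MeasurableSpace H]
  [BorelSpace H] in
theorem ProjectiveUnitaryRep.inner_apply_apply (π : ProjectiveUnitaryRep c E) (k m : H)
    (ψ φ : E) :
    inner ℂ ((π.toFun k : E →L[ℂ] E) ψ) ((π.toFun (k * m) : E →L[ℂ] E) φ)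
      = (c k m : ℂ) * π.coefficient ψ φ m := by
  rw [π.map_mul, _root_.smul_apply, inner_smul_right, mul_apply_eq_comp,
    ProjectiveUnitaryRep.coefficient]
  congr 1
  rw [← ContinuousLinearMap.adjoint_inner_right, ← ContinuousLinearMap.star_eq_adjoint,
    ← mul_apply_eq_comp, Unitary.coe_star_mul_self, one_apply_eq_self]

-- Cancel one unitary in `π(1) = c(1,1) π(1)²`; as `c` is not normalized, `π(1)` is only a scalar
-- phase.
omit [IsTopologicalGroup H] [T2Space H] [LocallyCompactSpace H] [MeasurableSpace H]
  [BorelSpace H] in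
theorem ProjectiveUnitaryRep.smul_toFun_one_apply (π : ProjectiveUnitaryRep c E) (φ : E) :
    (c 1 1 : ℂ) • (π.toFun 1 : E →L[ℂ] E) φ = φ := by
  have h := congrArg (fun T => star (π.toFun 1 : E →L[ℂ] E) * T) (π.map_mul 1 1)
  simp only [mul_one, mul_smul_comm, ← mul_assoc, Unitary.coe_star_mul_self, one_mul] at h
  exact (congrArg (fun T : E →L[ℂ] E => T φ) h).symm

-- Unitarity relates `π(h⁻¹)^*` to `π(h)` by exactly the phase that the involution compensates.
omit [LocallyCompactSpace H] in
theorem ProjectiveUnitaryRep.star_eq_self_of_coefficient (π : ProjectiveUnitaryRep c E)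
    {ψ : E} {F : TwistedCc c μ} (hF : ∀ h, F h = π.coefficient ψ ψ h) : star F = F := by
  ext h
  have h1 := π.inner_apply_apply h⁻¹ h ψ ψ
  rw [inv_mul_cancel] at h1
  have h2 : (c.starFactor h * (c 1 1 * c h⁻¹ h) : Circle) = 1 := by
    rw [GroupMultiplier.starFactor, c.inv_swap, ← mul_inv, inv_mul_cancel]
  have h3 := congrArg (fun z : Circle => (z : ℂ)) h2
  simp only [Circle.coe_mul, Circle.coe_one] at h3
  rw [star_apply, hF, hF]
  calc (c.starFactor h : ℂ) * (starRingEnd ℂ) (π.coefficient ψ ψ h⁻¹)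
      = c.starFactor h * ((c 1 1 : ℂ)
          * inner ℂ ((π.toFun h⁻¹ : E →L[ℂ] E) ψ) ((π.toFun 1 : E →L[ℂ] E) ψ)) := by
        rw [← inner_smul_right, π.smul_toFun_one_apply, ProjectiveUnitaryRep.coefficient,
          inner_conj_symm]
    _ = π.coefficient ψ ψ h := by
        rw [h1]
        linear_combination π.coefficient ψ ψ h * h3

open scoped TensorProduct in
/-- The cube of the image of a diagonal matrix coefficient is positive in every representation
of the twisted group algebra of an amenable group. -/
theorem TwistedRep.re_inner_rep_cube_nonneg [μ.IsHaarMeasure] [μ.Regular] [μ.IsMulRightInvariant]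
    (hH : IsAmenableGroup H) (ρ : TwistedRep c μ) (π : ProjectiveUnitaryRep c E)
    {ψ : E} {F : TwistedCc c μ} (hF : ∀ h, F h = π.coefficient ψ ψ h) (ζ : ρ.space) :
    0 ≤ (inner ℂ (ρ.rep F ζ) (ρ.rep F (ρ.rep F ζ))).re := by
  -- Tensoring the two projective orbits cancels their phases and leaves a kernel depending only on
  -- `k⁻¹l`.
  let W : H → E ⊗[ℂ] ρ.space := fun k =>
    (π.toFun k : E →L[ℂ] E) ψ ⊗ₜ[ℂ] ρ.rep (twistedTranslate k F) ζ
  let Φ : H → ℂ := fun h => F h * inner ℂ (ρ.rep F ζ) (ρ.rep (twistedTranslate h F) ζ)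
  have hΦ : Continuous Φ :=
    F.continuous.mul (continuous_const.inner
      ((ρ.continuous_translate F).clm_apply continuous_const))
  have hW : ∀ k l, inner ℂ (W k) (W l) = Φ (k⁻¹ * l) := by
    intro k l
    obtain ⟨m, rfl⟩ : ∃ m, l = k * m := ⟨k⁻¹ * l, by simp⟩
    rw [inv_mul_cancel_left, TensorProduct.inner_tmul, π.inner_apply_apply, ← hF, mul_right_comm,
      ρ.inner_translate, mul_comm]
  have h := hH.re_integral_nonneg μ (X := E ⊗[ℂ] ρ.space) (W := W) hΦ F.hasCompactSupport.mul_right hW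
  -- The integral of `Φ` is `⟨ρ(F)ζ, ρ(F * F)ζ⟩`.
  rwa [← ρ.inner_rep_mul, map_mul] at h

end Representation

/-! ### From positive cubes to positivity in `C^*(H, c)`. -/

section Positivity

/-- The hypothesis is positivity of the quadratic form on the range of `T`. It extends to the
closure by continuity, and a self-adjoint `T` vanishes on the orthogonal complement. -/
theorem ContinuousLinearMap.nonneg_of_re_inner_cube_nonneg {K : Type*} [NormedAddCommGroup K]
    [InnerProductSpace ℂ K] [CompleteSpace K] {T : K →L[ℂ] K} (hT : IsSelfAdjoint T)
    (h : ∀ ζ, 0 ≤ (inner ℂ (T ζ) (T (T ζ))).re) : 0 ≤ T := by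
  rw [ContinuousLinearMap.nonneg_iff_isPositive, ContinuousLinearMap.isPositive_def']
  refine ⟨hT, fun v => ?_⟩
  have hsymm : ∀ x y, inner ℂ (T x) y = inner ℂ x (T y) := hT.isSymmetric
  let S : Submodule ℂ K := T.range.topologicalClosure
  have : CompleteSpace S := (Submodule.isClosed_topologicalClosure _).completeSpace_coe
  obtain ⟨u, hu, w, hw, rfl⟩ := S.exists_add_mem_mem_orthogonal v
  have hTw : T w = 0 := by
    rw [← inner_self_eq_zero (𝕜 := ℂ), hsymm, ← inner_conj_symm,
      hw (T (T w)) (Submodule.le_topologicalClosure _ ⟨T w, rfl⟩), map_zero]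
  have hpos : ∀ x ∈ S, 0 ≤ (inner ℂ x (T x)).re := by
    intro x hx
    have hcl : IsClosed {x : K | 0 ≤ (inner ℂ x (T x)).re} :=
      isClosed_le continuous_const
        (Complex.continuous_re.comp (continuous_id.inner T.continuous))
    refine hcl.closure_subset_iff.2 ?_ hx
    rintro _ ⟨ζ, rfl⟩
    exact h ζ
  have e : T.reApplyInnerSelf (u + w) = (inner ℂ u (T u)).re := by
    rw [ContinuousLinearMap.reApplyInnerSelf_apply, map_add, hTw, add_zero, inner_add_right,
      hsymm u w, hTw, inner_zero_right, add_zero, hsymm]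
    rfl
  rw [e]
  exact hpos u hu

variable {H : Type*} [Group H] [TopologicalSpace H] [IsTopologicalGroup H] [T2Space H]
  [MeasurableSpace H] [BorelSpace H]
  {c : GroupMultiplier H} {μ : Measure H} [IsFiniteMeasureOnCompacts μ] [μ.IsMulRightInvariant]

/-- The representation of `C^*(H, c)` extending a representation of `C_c(H, c)`. -/
def TwistedRep.extend (ρ : TwistedRep c μ) :
    TwistedGroupCStarAlgebra c μ →⋆ₙₐ[ℂ] (ρ.space →L[ℂ] ρ.space) where
  toFun a := a.1 ρ
  map_smul' _ _ := rfl
  map_zero' := rfl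
  map_add' _ _ := rfl
  map_mul' _ _ := rfl
  map_star' _ := rfl

theorem TwistedRep.extend_toCStar (ρ : TwistedRep c μ) (f : TwistedCc c μ) :
    ρ.extend (TwistedCc.toCStar c μ f) = ρ.rep f := rfl

/-- A self-adjoint element of `C^*(H, c)` is positive if it is so in every representation. -/
theorem TwistedGroupCStarAlgebra.nonneg_of_forall_extend_nonneg
    {a : TwistedGroupCStarAlgebra c μ} (ha : IsSelfAdjoint a)
    (h : ∀ ρ : TwistedRep c μ, 0 ≤ ρ.extend a) : 0 ≤ a := by
  rw [CStarAlgebra.nonneg_iff_isSelfAdjoint_and_negPart_eq_zero]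
  refine ⟨ha, ?_⟩
  have hn : 0 ≤ a⁻ := CFC.negPart_nonneg a
  have hns : IsSelfAdjoint a⁻ := hn.isSelfAdjoint
  -- Compressing `a` by its negative part gives `-(a⁻)³`. In every representation this is
  -- nonnegative because `a` is, and nonpositive because `a⁻ ≥ 0`.
  have e : star a⁻ * a * a⁻ = -(star a⁻ * a⁻ * a⁻) := by
    have h : a⁻ * a = -(a⁻ * a⁻) := by
      calc a⁻ * a = a⁻ * (a⁺ - a⁻) := by rw [CFC.posPart_sub_negPart a ha]
        _ = -(a⁻ * a⁻) := by rw [mul_sub, CFC.negPart_mul_posPart, zero_sub]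
    rw [hns.star_eq, h, neg_mul]
  have h3 : ∀ ρ : TwistedRep c μ, ρ.extend (star a⁻ * a⁻ * a⁻) = 0 := by
    intro ρ
    refine le_antisymm ?_ ?_
    · rw [← neg_nonneg, ← map_neg, ← e, map_mul, map_mul, map_star]
      exact star_left_conjugate_nonneg (h ρ) _
    · obtain ⟨b, hb⟩ := CStarAlgebra.nonneg_iff_eq_star_mul_self.1 hn
      have hρ : 0 ≤ ρ.extend a⁻ := by
        rw [hb, map_mul, map_star]
        exact star_mul_self_nonneg _
      rw [map_mul, map_mul, map_star]
      exact star_left_conjugate_nonneg hρ _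
  -- Elements of `C^*(H, c)` are families indexed by the representations, so vanishing in each one
  -- suffices.
  have h4 : star a⁻ * a⁻ * a⁻ = 0 := by
    apply Subtype.ext
    ext ρ : 2
    exact h3 ρ
  -- Passing from the cube to the fourth power allows the `C^*`-identity to be applied twice.
  have h5 : star (star a⁻ * a⁻) * (star a⁻ * a⁻) = 0 := by
    rw [star_mul, star_star, ← mul_assoc]
    conv_lhs => rw [hns.star_eq]
    rw [hns.star_eq] at h4
    rw [h4, zero_mul]
  rw [CStarRing.star_mul_self_eq_zero_iff, CStarRing.star_mul_self_eq_zero_iff] at h5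
  exact h5

end Positivity

end

theorem proposition4 {H : Type*} [Group H] [TopologicalSpace H] [IsTopologicalGroup H]
    [LocallyCompactSpace H] [T2Space H] [MeasurableSpace H] [BorelSpace H]
    (μ : MeasureTheory.Measure H) [μ.IsHaarMeasure] [μ.Regular] [μ.IsMulRightInvariant]
    (hH : IsAmenableGroup H) (c : GroupMultiplier H)
    {E : Type*} [NormedAddCommGroup E] [InnerProductSpace ℂ E] [CompleteSpace E]
    (π : ProjectiveUnitaryRep c E) (L : Submodule ℂ E) (hL : π.IsAdmissible L) (ψ : L) :
    0 ≤ TwistedCc.toCStar c μ (π.riggingMap hL μ ψ ψ) := by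
  have hF : ∀ h, π.riggingMap hL μ ψ ψ h = π.coefficient ψ ψ h := fun _ => rfl
  have hstar : IsSelfAdjoint (π.riggingMap hL μ ψ ψ) := π.star_eq_self_of_coefficient hF
  refine TwistedGroupCStarAlgebra.nonneg_of_forall_extend_nonneg (hstar.map _) fun ρ => ?_
  rw [ρ.extend_toCStar]
  exact ContinuousLinearMap.nonneg_of_re_inner_cube_nonneg (hstar.map _)
    (ρ.re_inner_rep_cube_nonneg hH π hF)
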